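/- There is a universal constant $C>0$ such that the following holds for every integer $n\ge 2$ and every real $u>0$. Let $A$ be a random real $n\times n$ matrix whose entries are independent and subgaussian with variance proxy at most $1$; here a real random variable $X$ is subgaussian with variance proxy $s^2$ if $\mathbb{E}\exp(tX)\le\exp(s^2t^2/2)$ for all $t\in\mathbb{R}$. Then, with probability at least $1-\exp(-u^2)$, both of the following hold: (i) for all $x,y\in\mathbb{R}^n$ with $\|x\|_2=\|y\|_2=1$, $$x^\top A y\le C\,(\sqrt{\log n}+u)\,(\|x\|_1+\|y\|_1);$$ (ii) for all $x,y\in\mathbb{R}^n$ with $\|x\|_1\le 1$ and $\|y\|_1\le 1$, $$x^\top A y\le C\,(\sqrt{\log n}+u)\,(\|x\|_2+\|y\|_2).$$ -/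

import Mathlib

open MeasureTheory ProbabilityTheory
open scoped Matrix NNReal

/-- The `ℓ¹` norm of a real vector (the norm of `PiLp 1`). -/
noncomputable def l1Norm {n : ℕ} (x : Fin n → ℝ) : ℝ :=
  ‖(WithLp.toLp 1 x : PiLp 1 (fun _ : Fin n => ℝ))‖

/-- The `ℓ²` norm of a real vector (the norm of `EuclideanSpace ℝ (Fin n)`). -/
noncomputable def l2Norm {n : ℕ} (x : Fin n → ℝ) : ℝ :=
  ‖(WithLp.toLp 2 x : EuclideanSpace ℝ (Fin n))‖

/-! The union bound runs over nonzero integer vectors `z`, `w`, each pair weighted by its `ℓ¹`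
norms. The form `zᵀAw` is subgaussian with variance proxy `‖z‖₂²‖w‖₂²`, so it exceeds `3(√log n +
u)‖z‖₂‖w‖₂(√‖z‖₁ + √‖w‖₁)` with probability at most `e^{-u²} n^{-4‖z‖₁} n^{-4‖w‖₁}`. These weights
sum to at most `e^{-u²}` (`measure_not_intBilinBound_le`).

The rest is deterministic. Rescaled integer vectors form a net of the unit ball of each coordinate
subspace, which bounds the form on sparse vectors (`IntBilinBound.sparse`). A unit vector with `‖x‖₁
≤ √k` behaves, up to a factor 2, like a `k`-sparse one (`dotProduct_le_two_mul_of_sparse`); this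
gives (i), and (ii) follows by homogeneity. -/

theorem Int.exists_abs_le_abs_sub_le_one (t : ℝ) : ∃ z : ℤ, |(z : ℝ)| ≤ |t| ∧ |t - z| ≤ 1 := by
  rcases le_total 0 t with h | h
  · refine ⟨⌊t⌋, ?_, ?_⟩
    · have : (0 : ℝ) ≤ ⌊t⌋ := by exact_mod_cast Int.floor_nonneg.2 h
      rw [abs_of_nonneg this, abs_of_nonneg h]
      exact Int.floor_le t
    · rw [abs_le]
      constructor <;> linarith [Int.floor_le t, Int.lt_floor_add_one t]
  · refine ⟨⌈t⌉, ?_, ?_⟩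
    · have : (⌈t⌉ : ℝ) ≤ 0 := by exact_mod_cast Int.ceil_le.2 (by simpa using h)
      rw [abs_of_nonpos this, abs_of_nonpos h]
      linarith [Int.le_ceil t]
    · rw [abs_le]
      constructor <;> linarith [Int.le_ceil t, Int.ceil_lt_add_one t]

/-! ### From integer vectors to sparse vectors to unit vectors. -/

section Deterministic

variable {ι κ : Type*} [Fintype ι] [Fintype κ]

/-- The Euclidean unit ball of the coordinate subspace `ℝ^S`. -/
def coordBall (S : Finset ι) : Set (ι → ℝ) :=
  {x | (∀ i ∉ S, x i = 0) ∧ ∑ i, x i ^ 2 ≤ 1}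

/-- Integer vectors, rescaled by `4 √|S|`, with `ℓ¹` norm at most `4 |S|` before rescaling. -/
def coordNet (S : Finset ι) : Set (ι → ℝ) :=
  {x | ∃ z : ι → ℤ, (∀ i, x i = (4 * √(S.card : ℝ))⁻¹ * z i) ∧
    ∑ i, |(z i : ℝ)| ≤ 4 * S.card ∧ ∑ i, (z i : ℝ) ^ 2 ≤ 16 * S.card}

theorem isCompact_coordBall (S : Finset ι) : IsCompact (coordBall S) := by
  refine IsCompact.of_isClosed_subset (isCompact_closedBall (0 : ι → ℝ) 1) ?_ ?_
  · have : coordBall S = (⋂ i, ⋂ (_ : i ∉ S), {x : ι → ℝ | x i = 0}) ∩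
        {x | ∑ i, x i ^ 2 ≤ 1} := by
      ext x; simp [coordBall]
    rw [this]
    refine IsClosed.inter ?_ (isClosed_le (by fun_prop) (by fun_prop))
    exact isClosed_iInter fun i => isClosed_iInter fun _ =>
      isClosed_eq (by fun_prop) (by fun_prop)
  · rintro x ⟨-, hx⟩
    rw [mem_closedBall_zero_iff, pi_norm_le_iff_of_nonneg zero_le_one]
    intro i
    rw [Real.norm_eq_abs, ← sq_le_one_iff_abs_le_one]
    exact (Finset.single_le_sum (f := fun i => x i ^ 2) (fun j _ => sq_nonneg _)
      (Finset.mem_univ i)).trans hx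

theorem sum_eq_sum_of_coordBall {S : Finset ι} {x : ι → ℝ} (hx : ∀ i ∉ S, x i = 0)
    (f : ι → ℝ → ℝ) (hf : ∀ i, f i 0 = 0) : ∑ i, f i (x i) = ∑ i ∈ S, f i (x i) :=
  (Finset.sum_subset (Finset.subset_univ S) fun i _ hi => by rw [hx i hi, hf]).symm

theorem sum_abs_le_of_mem_coordBall {S : Finset ι} {x : ι → ℝ} (hx : x ∈ coordBall S) :
    ∑ i, |x i| ≤ √(S.card : ℝ) := by
  apply Real.le_sqrt_of_sq_le
  rw [sum_eq_sum_of_coordBall hx.1 (fun _ t => |t|) (by simp)]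
  have h1 := sq_sum_le_card_mul_sum_sq (s := S) (f := fun i => |x i|)
  have h2 : ∑ i ∈ S, |x i| ^ 2 ≤ 1 := by
    simp only [sq_abs]
    rw [← sum_eq_sum_of_coordBall hx.1 (fun _ t => t ^ 2) (by simp)]
    exact hx.2
  nlinarith [(Nat.cast_nonneg S.card : (0 : ℝ) ≤ S.card)]

/-- Rounding `4√|S| x` towards zero keeps the support and does not increase the norm. Each
coordinate on `S` moves by at most `1/(4√|S|)`, so the error has `ℓ²` norm at most `1/4`. -/
theorem exists_coordNet {S : Finset ι} (hS : S.Nonempty) {x : ι → ℝ} (hx : x ∈ coordBall S) :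
    ∃ x' ∈ coordNet S, x' ∈ coordBall S ∧ (4 : ℝ) • (x - x') ∈ coordBall S := by
  choose z hz using fun i => Int.exists_abs_le_abs_sub_le_one (4 * √(S.card : ℝ) * x i)
  have hk : (0 : ℝ) < S.card := by exact_mod_cast hS.card_pos
  set r := √(S.card : ℝ) with hr
  have hr0 : 0 < r := Real.sqrt_pos.2 hk
  have hr2 : r ^ 2 = S.card := Real.sq_sqrt hk.le
  have hz0 : ∀ i ∉ S, (z i : ℝ) = 0 := fun i hi => by
    have := (hz i).1
    simpa [hx.1 i hi] using this
  have hzle : ∀ i, |(z i : ℝ)| ≤ 4 * r * |x i| := fun i => by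
    have := (hz i).1
    rwa [abs_mul, abs_of_pos (by positivity : 0 < 4 * r)] at this
  have hzsq : ∑ i, (z i : ℝ) ^ 2 ≤ 16 * S.card := by
    calc ∑ i, (z i : ℝ) ^ 2 ≤ ∑ i, 16 * S.card * x i ^ 2 := by
          refine Finset.sum_le_sum fun i _ => ?_
          have := pow_le_pow_left₀ (abs_nonneg _) (hzle i) 2
          rw [sq_abs, mul_pow, sq_abs, mul_pow, hr2] at this
          linarith
      _ ≤ 16 * S.card := by
          rw [← Finset.mul_sum]
          have := hx.2
          nlinarith
  refine ⟨fun i => (4 * r)⁻¹ * z i, ⟨z, fun i => rfl, ?_, hzsq⟩, ⟨fun i hi => ?_, ?_⟩,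
    fun i hi => ?_, ?_⟩
  · calc ∑ i, |(z i : ℝ)| ≤ ∑ i, 4 * r * |x i| := Finset.sum_le_sum fun i _ => hzle i
      _ = 4 * r * ∑ i, |x i| := by rw [Finset.mul_sum]
      _ ≤ 4 * r * r := by gcongr; exact sum_abs_le_of_mem_coordBall hx
      _ = 4 * S.card := by rw [← hr2]; ring
  · simp [hz0 i hi]
  · simp only [mul_pow]
    rw [← Finset.mul_sum, inv_pow, mul_pow, hr2, inv_mul_le_iff₀ (by positivity)]
    linarith
  · simp [hz0 i hi, hx.1 i hi]
  · have h : ∀ i ∉ S, ((4 : ℝ) • (x - fun i => (4 * r)⁻¹ * (z i : ℝ))) i = 0 := fun i hi => by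
      simp [hz0 i hi, hx.1 i hi]
    rw [sum_eq_sum_of_coordBall h (fun _ t => t ^ 2) (by simp)]
    calc _ ≤ ∑ i ∈ S, (S.card : ℝ)⁻¹ := by
          refine Finset.sum_le_sum fun i _ => ?_
          have h1 : ((4 : ℝ) • (x - fun i => (4 * r)⁻¹ * (z i : ℝ))) i
              = r⁻¹ * (4 * r * x i - z i) := by
            simp only [Pi.smul_apply, Pi.sub_apply, smul_eq_mul]
            field_simp
          rw [h1, mul_pow, inv_pow, hr2]
          have h2 : (4 * r * x i - z i) ^ 2 ≤ 1 := (sq_le_one_iff_abs_le_one _).2 (hz i).2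
          exact mul_le_of_le_one_right (by positivity) h2
      _ = 1 := by
          rw [Finset.sum_const, nsmul_eq_mul]
          field_simp

/-- At a maximiser `(a, b)` with value `m`, split `aᵀBb = (a - a')ᵀBb + a'ᵀB(b - b') + a'ᵀBb'`. The
terms are at most `m/4`, `m/4` and `R`, hence `m ≤ 2R`. -/
theorem bilin_le_two_mul_of_net (B : Matrix ι κ ℝ) {K N : Set (ι → ℝ)} {L M : Set (κ → ℝ)}
    (hK : IsCompact K) (hL : IsCompact L) (hN : ∀ x ∈ K, ∃ x' ∈ N, x' ∈ K ∧ (4 : ℝ) • (x - x') ∈ K)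
    (hM : ∀ y ∈ L, ∃ y' ∈ M, y' ∈ L ∧ (4 : ℝ) • (y - y') ∈ L) {R : ℝ}
    (hR : ∀ x ∈ N, ∀ y ∈ M, x ⬝ᵥ (B *ᵥ y) ≤ R) {x : ι → ℝ} (hx : x ∈ K) {y : κ → ℝ} (hy : y ∈ L) :
    x ⬝ᵥ (B *ᵥ y) ≤ 2 * R := by
  have hc : Continuous fun p : (ι → ℝ) × (κ → ℝ) => p.1 ⬝ᵥ (B *ᵥ p.2) := by fun_prop
  obtain ⟨⟨a, b⟩, ⟨ha, hb⟩, hmax⟩ :=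
    (hK.prod hL).exists_isMaxOn ⟨(x, y), hx, hy⟩ hc.continuousOn
  have hle : ∀ x ∈ K, ∀ y ∈ L, x ⬝ᵥ (B *ᵥ y) ≤ a ⬝ᵥ (B *ᵥ b) := fun x hx y hy =>
    hmax (Set.mk_mem_prod hx hy)
  obtain ⟨a', ha', ha'K, hda⟩ := hN a ha
  obtain ⟨b', hb', hb'L, hdb⟩ := hM b hb
  have h1 := hle _ hda b hb
  have h2 := hle _ ha'K _ hdb
  have h3 := hR _ ha' _ hb'
  simp only [Matrix.mulVec_smul, Matrix.mulVec_sub, smul_dotProduct, dotProduct_smul,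
    sub_dotProduct, dotProduct_sub, smul_eq_mul] at h1 h2
  linarith [hle x hx y hy]

/-- Split the coordinates of `v` at height `R/√k`. At most `k` are larger, so they fall under the
sparse hypothesis; the others contribute at most `‖x‖₁ R/√k ≤ R`. -/
theorem dotProduct_le_two_mul_of_sparse {v : ι → ℝ} {k : ℕ} (hk : 0 < k) {R : ℝ} (hR : 0 ≤ R)
    (h : ∀ S : Finset ι, S.Nonempty → S.card ≤ k → ∀ x ∈ coordBall S, x ⬝ᵥ v ≤ R)
    {x : ι → ℝ} (hx2 : ∑ i, x i ^ 2 ≤ 1) (hx1 : ∑ i, |x i| ≤ √(k : ℝ)) : x ⬝ᵥ v ≤ 2 * R := by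
  classical
  have hk' : (0 : ℝ) < k := by exact_mod_cast hk
  have hs : 0 < √(k : ℝ) := Real.sqrt_pos.2 hk'
  have hss : √(k : ℝ) * √(k : ℝ) = k := Real.mul_self_sqrt hk'.le
  set t := R / √(k : ℝ) with ht
  have ht0 : 0 ≤ t := by positivity
  set S := Finset.univ.filter fun i => t < |v i| with hS
  have hcard : S.card ≤ k := by
    by_contra! hlt
    obtain ⟨S', hS', hcS'⟩ := Finset.exists_subset_card_eq hlt.le
    have hne : S'.Nonempty := Finset.card_pos.1 (by omega)
    -- With `k` large coordinates, the normalised sign vector pairs with `v` to more than `k · t/√k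
    -- = R`.
    set w : ι → ℝ := fun i => if i ∈ S' then SignType.sign (v i) / √(k : ℝ) else 0 with hw
    have hwb : w ∈ coordBall S' := by
      refine ⟨fun i hi => by simp [hw, hi], ?_⟩
      have h0 : ∀ i ∉ S', w i = 0 := fun i hi => by simp [hw, hi]
      rw [sum_eq_sum_of_coordBall h0 (fun _ t => t ^ 2) (by simp)]
      calc ∑ i ∈ S', w i ^ 2 ≤ ∑ i ∈ S', (k : ℝ)⁻¹ := by
            refine Finset.sum_le_sum fun i hi => ?_
            simp only [hw, hi, if_true, div_pow, Real.sq_sqrt hk'.le]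
            rw [← one_div]
            gcongr
            rcases lt_trichotomy (v i) 0 with h | h | h <;> simp [h]
        _ = 1 := by rw [Finset.sum_const, nsmul_eq_mul, hcS']; field_simp
    have h1 := h S' hne hcS'.le w hwb
    have h2 : w ⬝ᵥ v = ∑ i ∈ S', |v i| / √(k : ℝ) := by
      simp only [dotProduct, hw, ite_mul, zero_mul, Finset.sum_ite_mem, Finset.univ_inter]
      refine Finset.sum_congr rfl fun i _ => ?_
      rw [div_mul_eq_mul_div, sign_mul_self]
    have h3 : ∑ i ∈ S', t / √(k : ℝ) < ∑ i ∈ S', |v i| / √(k : ℝ) := by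
      refine Finset.sum_lt_sum_of_nonempty hne fun i hi => ?_
      have := (Finset.mem_filter.1 (hS' hi)).2
      gcongr
    rw [Finset.sum_const, nsmul_eq_mul, hcS', ht, div_div, hss, mul_div_cancel₀ _ hk'.ne'] at h3
    linarith
  have hbig : ∑ i ∈ S, x i * v i ≤ R := by
    rcases S.eq_empty_or_nonempty with he | hne
    · simpa [he] using hR
    · have hb : (fun i => if i ∈ S then x i else 0) ∈ coordBall S := by
        refine ⟨fun i hi => by simp [hi], le_trans (Finset.sum_le_sum fun i _ => ?_) hx2⟩
        by_cases hi : i ∈ S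
        · simp only [hi, if_true, le_refl]
        · simpa [hi] using sq_nonneg (x i)
      have := h S hne hcard _ hb
      simpa [dotProduct, ite_mul, Finset.sum_ite_mem] using this
  have hsmall : ∑ i ∈ Sᶜ, x i * v i ≤ R := by
    calc ∑ i ∈ Sᶜ, x i * v i ≤ ∑ i ∈ Sᶜ, |x i| * t := by
          refine Finset.sum_le_sum fun i hi => (le_abs_self _).trans ?_
          rw [abs_mul]
          have : |v i| ≤ t := by simpa [hS] using hi
          gcongr
      _ ≤ ∑ i, |x i| * t :=
          Finset.sum_le_sum_of_subset_of_nonneg (Finset.subset_univ _)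
            fun i _ _ => by positivity
      _ ≤ √(k : ℝ) * t := by rw [← Finset.sum_mul]; gcongr
      _ = R := by rw [ht]; field_simp
  rw [dotProduct, ← Finset.sum_add_sum_compl S]
  linarith

/-- The bound on integer vectors which the union bound provides. -/
def IntBilinBound (B : Matrix ι κ ℝ) (m₁ m₂ : ℕ) (K : ℝ) : Prop :=
  ∀ (z : ι → ℤ) (w : κ → ℤ), z ≠ 0 → w ≠ 0 → (∀ i, |z i| ≤ m₁) → (∀ j, |w j| ≤ m₂) →
    (fun i => (z i : ℝ)) ⬝ᵥ (B *ᵥ fun j => (w j : ℝ)) ≤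
      K * (√(∑ i, (z i : ℝ) ^ 2) * √(∑ j, (w j : ℝ) ^ 2) *
        (√(∑ i, |(z i : ℝ)|) + √(∑ j, |(w j : ℝ)|)))

theorem abs_le_of_sum_abs_le {S : Finset ι} {z : ι → ℤ} (h : ∑ i, |(z i : ℝ)| ≤ 4 * S.card)
    (i : ι) : |z i| ≤ (4 * Fintype.card ι : ℕ) := by
  have h1 : |(z i : ℝ)| ≤ 4 * S.card :=
    (Finset.single_le_sum (f := fun i => |(z i : ℝ)|) (fun j _ => abs_nonneg _)
      (Finset.mem_univ i)).trans h
  have h2 : (S.card : ℝ) ≤ Fintype.card ι := by exact_mod_cast Finset.card_le_univ S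
  have h3 : |(z i : ℝ)| ≤ 4 * Fintype.card ι := by linarith
  exact_mod_cast h3

theorem IntBilinBound.sparse {B : Matrix ι κ ℝ} {K : ℝ} (hK : 0 ≤ K)
    (h : IntBilinBound B (4 * Fintype.card ι) (4 * Fintype.card κ) K)
    {S : Finset ι} {T : Finset κ} (hS : S.Nonempty) (hT : T.Nonempty)
    {x : ι → ℝ} (hx : x ∈ coordBall S) {y : κ → ℝ} (hy : y ∈ coordBall T) :
    x ⬝ᵥ (B *ᵥ y) ≤ 4 * K * (√(S.card : ℝ) + √(T.card : ℝ)) := by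
  have hk : (0 : ℝ) < S.card := by exact_mod_cast hS.card_pos
  have hl : (0 : ℝ) < T.card := by exact_mod_cast hT.card_pos
  have key : ∀ x ∈ coordNet S, ∀ y ∈ coordNet T,
      x ⬝ᵥ (B *ᵥ y) ≤ 2 * K * (√(S.card : ℝ) + √(T.card : ℝ)) := by
    rintro x ⟨z, hz, hz1, hz2⟩ y ⟨w, hw, hw1, hw2⟩
    have hx : x = (4 * √(S.card : ℝ))⁻¹ • fun i => (z i : ℝ) := funext hz
    have hy : y = (4 * √(T.card : ℝ))⁻¹ • fun i => (w i : ℝ) := funext hw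
    rcases eq_or_ne z 0 with rfl | hz0
    · have : x = 0 := by rw [hx]; ext; simp
      rw [this, zero_dotProduct]; positivity
    rcases eq_or_ne w 0 with rfl | hw0
    · have : y = 0 := by rw [hy]; ext; simp
      rw [this, Matrix.mulVec_zero, dotProduct_zero]; positivity
    have hb := h z w hz0 hw0 (abs_le_of_sum_abs_le hz1) (abs_le_of_sum_abs_le hw1)
    set r := √(S.card : ℝ)
    set s := √(T.card : ℝ)
    have hr : 0 < r := Real.sqrt_pos.2 hk
    have hs : 0 < s := Real.sqrt_pos.2 hl
    have hr2 : r ^ 2 = S.card := Real.sq_sqrt hk.le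
    have hs2 : s ^ 2 = T.card := Real.sq_sqrt hl.le
    have e1 : √(∑ i, (z i : ℝ) ^ 2) ≤ 4 * r := Real.sqrt_le_iff.2 ⟨by positivity, by nlinarith⟩
    have e2 : √(∑ i, (w i : ℝ) ^ 2) ≤ 4 * s := Real.sqrt_le_iff.2 ⟨by positivity, by nlinarith⟩
    have e3 : √(∑ i, |(z i : ℝ)|) ≤ 2 * r := Real.sqrt_le_iff.2 ⟨by positivity, by nlinarith⟩
    have e4 : √(∑ i, |(w i : ℝ)|) ≤ 2 * s := Real.sqrt_le_iff.2 ⟨by positivity, by nlinarith⟩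
    -- The factors `4r` and `4s` cancel against the net scaling, leaving `2K(r + s)`; passing from
    -- the net to the balls doubles it.
    have hb' : (fun i => (z i : ℝ)) ⬝ᵥ (B *ᵥ fun j => (w j : ℝ)) ≤
        K * ((4 * r) * (4 * s) * (2 * r + 2 * s)) := hb.trans (by gcongr)
    rw [hx, hy, Matrix.mulVec_smul, smul_dotProduct, dotProduct_smul, smul_eq_mul, smul_eq_mul,
      inv_mul_le_iff₀ (by positivity), inv_mul_le_iff₀ (by positivity)]
    linarith
  have := bilin_le_two_mul_of_net B (isCompact_coordBall S) (isCompact_coordBall T)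
    (fun x hx => exists_coordNet hS hx) (fun y hy => exists_coordNet hT hy) key hx hy
  linarith

theorem one_le_sum_abs {x : ι → ℝ} (hx : ∑ i, x i ^ 2 = 1) : 1 ≤ ∑ i, |x i| := by
  have h := Finset.sum_sq_le_sq_sum_of_nonneg (s := Finset.univ) (f := fun i => |x i|)
    (fun i _ => abs_nonneg _)
  simp only [sq_abs, hx] at h
  exact (one_le_sq_iff₀ (Finset.sum_nonneg fun i _ => abs_nonneg _)).1 h

theorem exists_nat_sqrt {a : ℝ} (ha : 1 ≤ a) : ∃ k : ℕ, 0 < k ∧ a ≤ √(k : ℝ) ∧ √(k : ℝ) ≤ 2 * a := by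
  refine ⟨⌈a ^ 2⌉₊, Nat.ceil_pos.2 (by positivity), Real.le_sqrt_of_sq_le (Nat.le_ceil _),
    Real.sqrt_le_iff.2 ⟨by positivity, ?_⟩⟩
  have := Nat.ceil_lt_add_one (sq_nonneg a)
  nlinarith

/-- Sparsity is removed first from `x`, then from `y`, with `√k` and `√l` comparable to the `ℓ¹`
norms. The constant is `4 · 2 · 2 · 2`: sparse bound, two removals, rounding of `k` and `l`. -/
theorem IntBilinBound.unit {B : Matrix ι κ ℝ} {K : ℝ} (hK : 0 ≤ K)
    (h : IntBilinBound B (4 * Fintype.card ι) (4 * Fintype.card κ) K)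
    {x : ι → ℝ} (hx : ∑ i, x i ^ 2 = 1) {y : κ → ℝ} (hy : ∑ i, y i ^ 2 = 1) :
    x ⬝ᵥ (B *ᵥ y) ≤ 32 * K * (∑ i, |x i| + ∑ i, |y i|) := by
  obtain ⟨k, hk, hk1, hk2⟩ := exists_nat_sqrt (one_le_sum_abs hx)
  obtain ⟨l, hl, hl1, hl2⟩ := exists_nat_sqrt (one_le_sum_abs hy)
  set R := 4 * K * (√(k : ℝ) + √(l : ℝ)) with hR
  have hR0 : 0 ≤ R := by positivity
  have h1 : ∀ T : Finset κ, T.Nonempty → T.card ≤ l → ∀ y ∈ coordBall T,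
      y ⬝ᵥ (x ᵥ* B) ≤ 2 * R := by
    intro T hT hTl y hy
    rw [dotProduct_comm, ← Matrix.dotProduct_mulVec]
    refine dotProduct_le_two_mul_of_sparse hk hR0 (fun S hS hSk x hx => ?_) hx.le hk1
    refine (h.sparse hK hS hT hx hy).trans ?_
    rw [hR]
    gcongr
  have h2 := dotProduct_le_two_mul_of_sparse hl (by positivity) h1 hy.le hl1
  rw [dotProduct_comm, ← Matrix.dotProduct_mulVec] at h2
  refine h2.trans ?_
  have := mul_le_mul_of_nonneg_left (add_le_add hk2 hl2) hK
  rw [hR]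
  linarith

end Deterministic

/-! ### Norms, homogeneity and monotonicity of the variance proxy. -/

theorem l1Norm_eq {n : ℕ} (x : Fin n → ℝ) : l1Norm x = ∑ i, |x i| := by
  simp [l1Norm, PiLp.norm_eq_of_L1]

theorem l2Norm_eq {n : ℕ} (x : Fin n → ℝ) : l2Norm x = √(∑ i, x i ^ 2) := by
  simp [l2Norm, EuclideanSpace.norm_eq]

theorem l1Norm_smul {n : ℕ} (c : ℝ) (x : Fin n → ℝ) : l1Norm (c • x) = |c| * l1Norm x := by
  simp [l1Norm, WithLp.toLp_smul, norm_smul]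

theorem l2Norm_smul {n : ℕ} (c : ℝ) (x : Fin n → ℝ) : l2Norm (c • x) = |c| * l2Norm x := by
  simp [l2Norm, WithLp.toLp_smul, norm_smul]

theorem bilin_le_of_unit {n : ℕ} {B : Matrix (Fin n) (Fin n) ℝ} {K : ℝ}
    (h : ∀ x y : Fin n → ℝ, l2Norm x = 1 → l2Norm y = 1 →
      x ⬝ᵥ (B *ᵥ y) ≤ K * (l1Norm x + l1Norm y)) (x y : Fin n → ℝ) :
    x ⬝ᵥ (B *ᵥ y) ≤ K * (l1Norm x * l2Norm y + l1Norm y * l2Norm x) := by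
  rcases eq_or_ne x 0 with rfl | hx
  · simp [l1Norm, l2Norm]
  rcases eq_or_ne y 0 with rfl | hy
  · simp [l1Norm, l2Norm]
  have hx' : 0 < l2Norm x := by simpa [l2Norm] using hx
  have hy' : 0 < l2Norm y := by simpa [l2Norm] using hy
  have := h ((l2Norm x)⁻¹ • x) ((l2Norm y)⁻¹ • y)
    (by rw [l2Norm_smul, abs_of_pos (by positivity), inv_mul_cancel₀ hx'.ne'])
    (by rw [l2Norm_smul, abs_of_pos (by positivity), inv_mul_cancel₀ hy'.ne'])
  rw [l1Norm_smul, l1Norm_smul, abs_of_pos (by positivity), abs_of_pos (by positivity),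
    Matrix.mulVec_smul, smul_dotProduct, dotProduct_smul, smul_eq_mul, smul_eq_mul,
    inv_mul_le_iff₀ hx', inv_mul_le_iff₀ hy'] at this
  refine this.trans_eq ?_
  field_simp

theorem ProbabilityTheory.HasSubgaussianMGF.mono {Ω : Type*} [MeasurableSpace Ω] {μ : Measure Ω}
    {X : Ω → ℝ} {c d : ℝ≥0} (h : HasSubgaussianMGF X c μ) (hcd : c ≤ d) :
    HasSubgaussianMGF X d μ where
  integrable_exp_mul := h.integrable_exp_mul
  mgf_le t := (h.mgf_le t).trans (by gcongr)

/-! ### Tail estimate and weighted union bound over integer vectors. -/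

section Probability

variable {Ω : Type*} [MeasurableSpace Ω] {μ : Measure Ω} {ι κ : Type*} [Fintype ι] [Fintype κ]

theorem measure_bilin_ge_le {A : Ω → Matrix ι κ ℝ}
    (hind : iIndepFun (fun (p : ι × κ) (ω : Ω) => A ω p.1 p.2) μ)
    (hsub : ∀ i j, HasSubgaussianMGF (fun ω => A ω i j) 1 μ) (x : ι → ℝ) (y : κ → ℝ)
    {ε : ℝ} (hε : 0 ≤ ε) :
    μ.real {ω | ε ≤ x ⬝ᵥ (A ω *ᵥ y)} ≤
      Real.exp (-ε ^ 2 / (2 * ((∑ i, x i ^ 2) * ∑ j, y j ^ 2))) := by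
  have hind' : iIndepFun (fun (p : ι × κ) (ω : Ω) => (x p.1 * y p.2) * A ω p.1 p.2) μ :=
    hind.comp (fun p t => (x p.1 * y p.2) * t) fun p => by fun_prop
  have h := HasSubgaussianMGF.measure_sum_ge_le_of_iIndepFun hind' (s := Finset.univ)
    (fun p _ => (hsub p.1 p.2).const_mul (x p.1 * y p.2)) hε
  have e1 : ∀ ω, ∑ p : ι × κ, (x p.1 * y p.2) * A ω p.1 p.2 = x ⬝ᵥ (A ω *ᵥ y) := fun ω => by
    simp only [dotProduct, Matrix.mulVec, Fintype.sum_prod_type, Finset.mul_sum]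
    exact Finset.sum_congr rfl fun i _ => Finset.sum_congr rfl fun j _ => by ring
  have e2 : ∑ p : ι × κ, (x p.1 * y p.2) ^ 2 = (∑ i, x i ^ 2) * ∑ j, y j ^ 2 := by
    simp only [Fintype.sum_prod_type, mul_pow, Finset.sum_mul_sum]
  simp only [e1] at h
  rw [← e2]
  refine h.trans_eq ?_
  congr 2
  push_cast
  congr 1
  exact Finset.sum_congr rfl fun p _ => mul_one ((x p.1 * y p.2) ^ 2)

theorem sum_pow_natAbs_Icc_le {r : ℝ} (hr0 : 0 ≤ r) (hr : r ≤ 1 / 2) (m : ℕ) :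
    ∑ k ∈ Finset.Icc (-(m : ℤ)) m, r ^ k.natAbs ≤ 1 + 4 * r := by
  have h : ∀ m : ℕ, ∑ k ∈ Finset.Icc (-(m : ℤ)) m, r ^ k.natAbs
      = 1 + 2 * ∑ k ∈ Finset.range m, r ^ (k + 1) := by
    intro m
    induction m with
    | zero => simp
    | succ m ih =>
      have e : Finset.Icc (-((m + 1 : ℕ) : ℤ)) (m + 1 : ℕ)
          = insert (-((m + 1 : ℕ) : ℤ)) (insert ((m + 1 : ℕ) : ℤ) (Finset.Icc (-(m : ℤ)) m)) := by
        ext k; simp only [Finset.mem_insert, Finset.mem_Icc]; omega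
      rw [e, Finset.sum_insert (by simp only [Finset.mem_insert, Finset.mem_Icc]; omega),
        Finset.sum_insert (by simp only [Finset.mem_Icc]; omega), ih, Finset.sum_range_succ,
        Int.natAbs_neg, Int.natAbs_natCast]
      ring
  have hg : ∑ k ∈ Finset.range m, r ^ k ≤ 2 := by
    rw [geom_sum_eq (by linarith), ← neg_div_neg_eq, div_le_iff₀ (by linarith)]
    have := pow_nonneg hr0 m
    linarith
  rw [h]
  simp only [pow_succ, ← Finset.sum_mul]
  nlinarith

/-- The sum over the whole box factors over coordinates and is at most `(1 + 4r)^|ι| ≤ e^{1/2} ≤ 2`;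
removing the zero vector subtracts 1. -/
theorem sum_prod_pow_natAbs_le (ι : Type*) [Fintype ι] [DecidableEq ι] {r : ℝ} (hr0 : 0 ≤ r)
    (hr : r ≤ 1 / 2) (hιr : Fintype.card ι * (4 * r) ≤ 1 / 2) (m : ℕ) :
    ∑ z ∈ (Fintype.piFinset fun _ : ι => Finset.Icc (-(m : ℤ)) m).erase 0,
      r ^ (∑ i, (z i).natAbs) ≤ 1 := by
  have h0 : (0 : ι → ℤ) ∈ Fintype.piFinset fun _ : ι => Finset.Icc (-(m : ℤ)) m := by simp
  have h1 := Finset.sum_erase_eq_sub (f := fun z : ι → ℤ => r ^ (∑ i, (z i).natAbs)) h0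
  rw [h1]
  simp only [← Finset.prod_pow_eq_pow_sum]
  rw [← Finset.prod_univ_sum (fun _ : ι => Finset.Icc (-(m : ℤ)) m) fun _ k => r ^ k.natAbs]
  have h2 : ∏ _i : ι, ∑ k ∈ Finset.Icc (-(m : ℤ)) m, r ^ k.natAbs ≤ 2 := by
    rw [Finset.prod_const, Finset.card_univ]
    calc _ ≤ (Real.exp (4 * r)) ^ Fintype.card ι := by
          refine pow_le_pow_left₀ (Finset.sum_nonneg fun k _ => by positivity)
            ((sum_pow_natAbs_Icc_le hr0 hr m).trans ?_) _
          linarith [Real.add_one_le_exp (4 * r)]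
      _ = Real.exp (Fintype.card ι * (4 * r)) := (Real.exp_nat_mul _ _).symm
      _ ≤ Real.exp (Real.log 2) := by
          gcongr
          linarith [Real.log_two_gt_d9]
      _ = 2 := Real.exp_log two_pos
  simp only [Pi.zero_apply, Int.natAbs_zero, pow_zero, Finset.prod_const_one]
  linarith

theorem sum_sq_pos_of_ne_zero {z : ι → ℤ} (hz : z ≠ 0) : 0 < ∑ i, (z i : ℝ) ^ 2 := by
  obtain ⟨i, hi⟩ := Function.ne_iff.1 hz
  have hi' : (z i : ℝ) ≠ 0 := by exact_mod_cast hi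
  exact Finset.sum_pos' (fun _ _ => sq_nonneg _) ⟨i, Finset.mem_univ i, by positivity⟩

theorem sum_natAbs_pos_of_ne_zero {z : ι → ℤ} (hz : z ≠ 0) : 1 ≤ ∑ i, (z i).natAbs := by
  obtain ⟨i, hi⟩ := Function.ne_iff.1 hz
  exact Finset.sum_pos' (fun _ _ => Nat.zero_le _) ⟨i, Finset.mem_univ i, Int.natAbs_pos.2 hi⟩

theorem cast_sum_natAbs (z : ι → ℤ) : ((∑ i, (z i).natAbs : ℕ) : ℝ) = ∑ i, |(z i : ℝ)| := by
  push_cast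
  exact Finset.sum_congr rfl fun i _ => by rw [Nat.cast_natAbs, Int.cast_abs]

theorem measure_int_bilin_ge_le {A : Ω → Matrix ι κ ℝ}
    (hind : iIndepFun (fun (p : ι × κ) (ω : Ω) => A ω p.1 p.2) μ)
    (hsub : ∀ i j, HasSubgaussianMGF (fun ω => A ω i j) 1 μ) {L u : ℝ} (hL : 0 ≤ L) (hu : 0 ≤ u)
    {z : ι → ℤ} (hz : z ≠ 0) {w : κ → ℤ} (hw : w ≠ 0) :
    μ.real {ω | 3 * (√L + u) * (√(∑ i, (z i : ℝ) ^ 2) * √(∑ j, (w j : ℝ) ^ 2) *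
        (√(∑ i, |(z i : ℝ)|) + √(∑ j, |(w j : ℝ)|))) ≤
        (fun i => (z i : ℝ)) ⬝ᵥ (A ω *ᵥ fun j => (w j : ℝ))} ≤
      Real.exp (-u ^ 2) * (Real.exp (-(4 * L)) ^ (∑ i, (z i).natAbs) *
        Real.exp (-(4 * L)) ^ (∑ j, (w j).natAbs)) := by
  refine (measure_bilin_ge_le hind hsub _ _ (by positivity)).trans ?_
  rw [← cast_sum_natAbs, ← cast_sum_natAbs, ← Real.exp_nat_mul, ← Real.exp_nat_mul,
    ← Real.exp_add, ← Real.exp_add, Real.exp_le_exp]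
  have hP := sum_sq_pos_of_ne_zero hz
  have hQ := sum_sq_pos_of_ne_zero hw
  have hm : (1 : ℝ) ≤ (∑ i, (z i).natAbs : ℕ) := by exact_mod_cast sum_natAbs_pos_of_ne_zero hz
  have hl : (1 : ℝ) ≤ (∑ j, (w j).natAbs : ℕ) := by exact_mod_cast sum_natAbs_pos_of_ne_zero hw
  generalize ∑ i, (z i : ℝ) ^ 2 = P at *
  generalize ∑ i, (w i : ℝ) ^ 2 = Q at *
  generalize ((∑ i, (z i).natAbs : ℕ) : ℝ) = m at *
  generalize ((∑ i, (w i).natAbs : ℕ) : ℝ) = l at *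
  -- The constant 3 yields `9/2`, enough for the `4L(m + l)` in the weights; the same factor covers
  -- `u²` since `m + l ≥ 1`.
  have e : -(3 * (√L + u) * (√P * √Q * (√m + √l))) ^ 2 / (2 * (P * Q))
      = -(9 / 2 * (√L + u) ^ 2 * (√m + √l) ^ 2) := by
    simp only [mul_pow, Real.sq_sqrt hP.le, Real.sq_sqrt hQ.le]
    field_simp
    ring
  have h1 : m + l ≤ (√m + √l) ^ 2 := by
    rw [add_sq, Real.sq_sqrt (by linarith), Real.sq_sqrt (by linarith)]
    have : 0 ≤ 2 * √m * √l := by positivity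
    linarith
  have h2 : L + u ^ 2 ≤ (√L + u) ^ 2 := by
    rw [add_sq, Real.sq_sqrt hL]
    have : 0 ≤ 2 * √L * u := by positivity
    linarith
  have h3 : (L + u ^ 2) * (m + l) ≤ (√L + u) ^ 2 * (√m + √l) ^ 2 := by gcongr
  have h4 : u ^ 2 * 1 ≤ u ^ 2 * (m + l) := by gcongr; linarith
  have h5 : 0 ≤ L * (m + l) := by positivity
  have h6 : 0 ≤ (√L + u) ^ 2 * (√m + √l) ^ 2 := by positivity
  rw [e]
  nlinarith only [h3, h4, h5, h6, sq_nonneg u]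

theorem measure_not_intBilinBound_le [IsProbabilityMeasure μ] {A : Ω → Matrix ι κ ℝ}
    (hind : iIndepFun (fun (p : ι × κ) (ω : Ω) => A ω p.1 p.2) μ)
    (hsub : ∀ i j, HasSubgaussianMGF (fun ω => A ω i j) 1 μ) {L u : ℝ} (hL : 0 ≤ L) (hu : 0 ≤ u)
    (hL' : Real.exp (-(4 * L)) ≤ 1 / 2)
    (hι : Fintype.card ι * (4 * Real.exp (-(4 * L))) ≤ 1 / 2)
    (hκ : Fintype.card κ * (4 * Real.exp (-(4 * L))) ≤ 1 / 2) (m₁ m₂ : ℕ) :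
    μ.real {ω | ¬ IntBilinBound (A ω) m₁ m₂ (3 * (√L + u))} ≤ Real.exp (-u ^ 2) := by
  classical
  set F := (Fintype.piFinset fun _ : ι => Finset.Icc (-(m₁ : ℤ)) m₁).erase 0
  set G := (Fintype.piFinset fun _ : κ => Finset.Icc (-(m₂ : ℤ)) m₂).erase 0
  set bad : (ι → ℤ) × (κ → ℤ) → Set Ω := fun p =>
    {ω | 3 * (√L + u) * (√(∑ i, (p.1 i : ℝ) ^ 2) * √(∑ j, (p.2 j : ℝ) ^ 2) *
        (√(∑ i, |(p.1 i : ℝ)|) + √(∑ j, |(p.2 j : ℝ)|))) ≤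
        (fun i => (p.1 i : ℝ)) ⬝ᵥ (A ω *ᵥ fun j => (p.2 j : ℝ))}
  have hsubset : {ω | ¬ IntBilinBound (A ω) m₁ m₂ (3 * (√L + u))} ⊆ ⋃ p ∈ F ×ˢ G, bad p := by
    intro ω hω
    simp only [Set.mem_ofPred_eq, IntBilinBound, not_forall, not_le] at hω
    obtain ⟨z, w, hz, hw, hzm, hwm, hlt⟩ := hω
    refine Set.mem_biUnion (x := (z, w)) ?_ hlt.le
    simp only [Finset.coe_product, Set.mem_prod, Finset.mem_coe, F, G, Finset.mem_erase,
      Fintype.mem_piFinset, Finset.mem_Icc]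
    exact ⟨⟨hz, fun i => abs_le.1 (hzm i)⟩, hw, fun j => abs_le.1 (hwm j)⟩
  have hne : ∀ p ∈ F ×ˢ G, p.1 ≠ 0 ∧ p.2 ≠ 0 := fun p hp =>
    ⟨Finset.ne_of_mem_erase (Finset.mem_product.1 hp).1,
      Finset.ne_of_mem_erase (Finset.mem_product.1 hp).2⟩
  calc _ ≤ μ.real (⋃ p ∈ F ×ˢ G, bad p) := measureReal_mono hsubset (measure_ne_top μ _)
    _ ≤ ∑ p ∈ F ×ˢ G, μ.real (bad p) := measureReal_biUnion_finset_le _ _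
    _ ≤ ∑ p ∈ F ×ˢ G, Real.exp (-u ^ 2) * (Real.exp (-(4 * L)) ^ (∑ i, (p.1 i).natAbs) *
          Real.exp (-(4 * L)) ^ (∑ j, (p.2 j).natAbs)) :=
        Finset.sum_le_sum fun p hp =>
          measure_int_bilin_ge_le hind hsub hL hu (hne p hp).1 (hne p hp).2
    _ = Real.exp (-u ^ 2) * ((∑ z ∈ F, Real.exp (-(4 * L)) ^ (∑ i, (z i).natAbs)) *
          ∑ w ∈ G, Real.exp (-(4 * L)) ^ (∑ j, (w j).natAbs)) := by
        rw [← Finset.mul_sum, Finset.sum_mul_sum, Finset.sum_product]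
    _ ≤ Real.exp (-u ^ 2) * (1 * 1) := by
        gcongr
        · exact sum_prod_pow_natAbs_le ι (by positivity) hL' hι m₁
        · exact sum_prod_pow_natAbs_le κ (by positivity) hL' hκ m₂
    _ = _ := by ring

end Probability

/-! ### Numerical check at `L = log n` and conclusion. -/

theorem exp_neg_four_mul_log_le {n : ℕ} (hn : 2 ≤ n) :
    Real.exp (-(4 * Real.log n)) ≤ 1 / 2 ∧
      n * (4 * Real.exp (-(4 * Real.log n))) ≤ 1 / 2 := by
  have hn' : (2 : ℝ) ≤ n := by exact_mod_cast hn
  have h0 : (0 : ℝ) < n := by linarith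
  have e : Real.exp (-(4 * Real.log n)) = ((n : ℝ) ^ 4)⁻¹ := by
    rw [Real.exp_neg, show 4 * Real.log n = ((4 : ℕ) : ℝ) * Real.log n by norm_num,
      Real.exp_nat_mul, Real.exp_log h0]
  have h3 : (2 : ℝ) ^ 3 ≤ (n : ℝ) ^ 3 := by gcongr
  have h4 : (2 : ℝ) ^ 4 ≤ (n : ℝ) ^ 4 := by gcongr
  rw [e]
  constructor
  · rw [← one_div]
    exact one_div_le_one_div_of_le two_pos (by linarith)
  · have : (n : ℝ) * (4 * ((n : ℝ) ^ 4)⁻¹) = 4 / (n : ℝ) ^ 3 := by field_simp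
    rw [this, div_le_iff₀ (by positivity)]
    linarith

theorem lemma2p1 :
    ∃ C : ℝ, 0 < C ∧
      ∀ (n : ℕ), 2 ≤ n →
      ∀ (Ω : Type*) [MeasurableSpace Ω] (μ : Measure Ω) [IsProbabilityMeasure μ]
        (A : Ω → Matrix (Fin n) (Fin n) ℝ),
        (∀ i j, Measurable (fun ω => A ω i j)) →
        iIndepFun (fun (p : Fin n × Fin n) (ω : Ω) => A ω p.1 p.2) μ →
        (∀ i j, ∃ s2 : ℝ≥0, s2 ≤ 1 ∧ HasSubgaussianMGF (fun ω => A ω i j) s2 μ) →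
        ∀ u : ℝ, 0 < u →
          1 - Real.exp (-u ^ 2) ≤
            μ.real {ω |
              (∀ x y : Fin n → ℝ, l2Norm x = 1 → l2Norm y = 1 →
                x ⬝ᵥ (A ω *ᵥ y) ≤
                  C * (Real.sqrt (Real.log n) + u) * (l1Norm x + l1Norm y)) ∧
              (∀ x y : Fin n → ℝ, l1Norm x ≤ 1 → l1Norm y ≤ 1 →
                x ⬝ᵥ (A ω *ᵥ y) ≤
                  C * (Real.sqrt (Real.log n) + u) * (l2Norm x + l2Norm y))} := by
  -- Here `96 = 32 · 3`, from `IntBilinBound.unit` and the threshold in the union bound.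
  refine ⟨96, by norm_num, fun n hn Ω _ μ _ A _ hind hsub u hu => ?_⟩
  have hsub1 : ∀ i j, HasSubgaussianMGF (fun ω => A ω i j) 1 μ := fun i j => by
    obtain ⟨s2, hs2, h⟩ := hsub i j
    exact h.mono hs2
  obtain ⟨hr, hnr⟩ := exp_neg_four_mul_log_le hn
  set K := √(Real.log n) + u with hK
  have hK0 : 0 ≤ K := by positivity
  set E : Set Ω := {ω | IntBilinBound (A ω) (4 * n) (4 * n) (3 * K)}
  have hE : μ.real Eᶜ ≤ Real.exp (-u ^ 2) :=
    measure_not_intBilinBound_le hind hsub1 (Real.log_natCast_nonneg n) hu.le hr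
      (by simpa using hnr) (by simpa using hnr) (4 * n) (4 * n)
  -- Subadditivity suffices, so `E` need not be shown measurable.
  have hone : 1 ≤ μ.real E + μ.real Eᶜ := by
    rw [← probReal_univ (μ := μ), ← Set.union_compl_self E]
    exact measureReal_union_le _ _
  refine (by linarith : 1 - Real.exp (-u ^ 2) ≤ μ.real E).trans (measureReal_mono fun ω hω => ?_)
  have hunit : ∀ x y : Fin n → ℝ, l2Norm x = 1 → l2Norm y = 1 →
      x ⬝ᵥ (A ω *ᵥ y) ≤ 96 * K * (l1Norm x + l1Norm y) := fun x y hx hy => by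
    rw [l2Norm_eq, Real.sqrt_eq_one] at hx hy
    have hω' : IntBilinBound (A ω) (4 * Fintype.card (Fin n)) (4 * Fintype.card (Fin n))
        (3 * K) := by
      rw [Fintype.card_fin]
      exact hω
    rw [l1Norm_eq, l1Norm_eq]
    refine (hω'.unit (by positivity) hx hy).trans_eq ?_
    ring
  refine ⟨hunit, fun x y hx hy => (bilin_le_of_unit hunit x y).trans ?_⟩
  have hx2 : 0 ≤ l2Norm x := norm_nonneg _
  have hy2 : 0 ≤ l2Norm y := norm_nonneg _
  have := mul_le_mul_of_nonneg_right hx hy2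
  have := mul_le_mul_of_nonneg_right hy hx2
  refine mul_le_mul_of_nonneg_left ?_ (by positivity)
  linarith
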